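/- Call $x=(x_i)_{i\in\mathbb Z}$ a bidding sequence if it is a nondecreasing bi-infinite sequence of positive reals such that for every threshold $u>0$ there is an index $i$ with $x_{i-1}<u\le x_i$; for this index put $\operatorname{cost}(x,u)=\sum_{j\le i}x_j\in[0,\infty]$. A randomized bidding sequence is a sequence $X=(X_i)_{i\in\mathbb Z}$ of real random variables on a probability space that is almost surely a bidding sequence. For $u>0$ let $\operatorname{nc}(X,u)=\mathbb E[\operatorname{cost}(X,u)]/u\in[0,\infty]$, and let $$\operatorname{cons}(X)=\inf_{u>0}\operatorname{nc}(X,u),\qquad \operatorname{rob}(X)=\sup_{u>0}\operatorname{nc}(X,u).$$ A bidding function is a nondecreasing function $B:\mathbb R\to(0,\infty)$ with $\lim_{t\to-\infty}B(t)=0$, $\lim_{t\to+\infty}B(t)=+\infty$ and $\int_{-\infty}^tB(x)\,dx<\infty$ for all $t\in\mathbb R$. Its consistency and robustness are $$\operatorname{cons}(B)=\inf_{t\in\mathbb R}\int_{-\infty}^{t+1}\frac{B(x)}{B(t)}\,dx,\qquad \operatorname{rob}(B)=\sup_{t\in\mathbb R}\int_{-\infty}^{t+1}\frac{B(x)}{B(t)}\,dx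 .$$ **Theorem.** For every randomized bidding sequence $X$ there is a bidding function $B$ such that $$\operatorname{cons}(B)\le\operatorname{cons}(X)\qquad\text{and}\qquad\operatorname{rob}(B)\le\operatorname{rob}(X).$$ Moreover, if $\operatorname{nc}(X,u)<\infty$ for all $u>0$ (in particular if $\operatorname{rob}(X)<\infty$), these inequalities hold for the generalized inverse $B(t)=\inf\{v>0: F(v)>t\}$ of the expected bid-counting function $F(v)=\mathbb E\big[\sum_{k\in\mathbb Z}(\mathbf 1[X_k<v]-\mathbf 1[X_k<1])\big]$, which is then a bidding function. -/

import Mathlib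

open MeasureTheory Filter Topology
open scoped ENNReal

noncomputable section

namespace OnlineBidding

/-- A deterministic bi-infinite bidding sequence: positive bids, in increasing order (repetitions are
allowed), such that every threshold `u > 0` is reached by a well-defined first bid `x i ≥ u`. -/
structure IsBiddingSequence (x : ℤ → ℝ) : Prop where
  pos : ∀ i, 0 < x i
  mono : Monotone x
  reaches : ∀ u : ℝ, 0 < u → ∃ i, x (i - 1) < u ∧ u ≤ x i

/-- The cost `∑_{j ≤ i} x j`, where `i` is the index with `x (i - 1) < u ≤ x i`. For a bidding
sequence and `u > 0` this index exists and is unique, so the infimum is over a single value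
(see `cost_eq`). -/
def cost (x : ℤ → ℝ) (u : ℝ) : ℝ≥0∞ :=
  ⨅ (i : ℤ) (_ : x (i - 1) < u ∧ u ≤ x i), ∑' j : Set.Iic i, ENNReal.ofReal (x j)

theorem cost_eq {x : ℤ → ℝ} (hx : IsBiddingSequence x) {u : ℝ} {i : ℤ}
    (h1 : x (i - 1) < u) (h2 : u ≤ x i) :
    cost x u = ∑' j : Set.Iic i, ENNReal.ofReal (x j) := by
  apply le_antisymm
  · exact iInf₂_le_of_le i ⟨h1, h2⟩ le_rfl
  · refine le_iInf₂ fun k hk => ?_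
    have hki : k = i := by
      rcases lt_trichotomy k i with h | h | h
      · have := hx.mono (show k ≤ i - 1 by omega)
        linarith [hk.2]
      · exact h
      · have := hx.mono (show i ≤ k - 1 by omega)
        linarith [hk.1]
    subst hki
    exact le_rfl

/-- A randomized bidding sequence: random bids `X i : Ω → ℝ` on a measure space `(Ω, μ)`
(`μ` will be a probability measure) that almost surely form a bidding sequence. -/
structure IsRandomizedBiddingSequence {Ω : Type*} [MeasurableSpace Ω] (μ : Measure Ω)
    (X : ℤ → Ω → ℝ) : Prop where
  measurable : ∀ i, Measurable (X i)
  ae_isBiddingSequence : ∀ᵐ ω ∂μ, IsBiddingSequence (fun i => X i ω)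

/-- The normalized expected cost `nc(X, u) = 𝔼[cost(X, u)] / u`. -/
def normalizedCost {Ω : Type*} [MeasurableSpace Ω] (μ : Measure Ω) (X : ℤ → Ω → ℝ) (u : ℝ) :
    ℝ≥0∞ :=
  (∫⁻ ω, cost (fun i => X i ω) u ∂μ) / ENNReal.ofReal u

/-- `cons(X) = inf_{u > 0} nc(X, u)`. -/
def seqConsistency {Ω : Type*} [MeasurableSpace Ω] (μ : Measure Ω) (X : ℤ → Ω → ℝ) : ℝ≥0∞ :=
  ⨅ (u : ℝ) (_ : 0 < u), normalizedCost μ X u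

/-- `rob(X) = sup_{u > 0} nc(X, u)`. -/
def seqRobustness {Ω : Type*} [MeasurableSpace Ω] (μ : Measure Ω) (X : ℤ → Ω → ℝ) : ℝ≥0∞ :=
  ⨆ (u : ℝ) (_ : 0 < u), normalizedCost μ X u

/-- A bidding function: a positive nondecreasing `B : ℝ → ℝ` with limits `0` at `-∞` and `+∞` at
`+∞` and with `∫_{-∞}^t B(x) dx` finite for all `t`. -/
structure IsBiddingFunction (B : ℝ → ℝ) : Prop where
  pos : ∀ t, 0 < B t
  mono : Monotone B
  tendsto_atBot : Tendsto B atBot (𝓝 0)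
  tendsto_atTop : Tendsto B atTop atTop
  integrableOn : ∀ t, IntegrableOn B (Set.Iic t)

/-- The normalized mass `∫_{-∞}^{t+1} B(x) / B(t) dx`. -/
def normalizedMass (B : ℝ → ℝ) (t : ℝ) : ℝ≥0∞ :=
  ∫⁻ x in Set.Iic (t + 1), ENNReal.ofReal (B x / B t)

/-- `cons(B)`, the infimum of the normalized mass over all reference points. -/
def fctConsistency (B : ℝ → ℝ) : ℝ≥0∞ := ⨅ t : ℝ, normalizedMass B t

/-- `rob(B)`, the supremum of the normalized mass over all reference points. -/
def fctRobustness (B : ℝ → ℝ) : ℝ≥0∞ := ⨆ t : ℝ, normalizedMass B t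

/-- The number of bids in `[1, v)`, or, if `v < 1`, minus the number of bids in `[v, 1)`.
For a bidding sequence and `v > 0` only finitely many summands are nonzero. -/
def bidCount (x : ℤ → ℝ) (v : ℝ) : ℝ :=
  ∑' k : ℤ, ((if x k < v then 1 else 0) - (if x k < 1 then 1 else 0) : ℝ)

/-- The expected bid-counting function `F(v) = 𝔼[N(v)]`. -/
def expectedBidCount {Ω : Type*} [MeasurableSpace Ω] (μ : Measure Ω) (X : ℤ → Ω → ℝ) (v : ℝ) : ℝ :=
  ∫ ω, bidCount (fun i => X i ω) v ∂μ

/-- The generalized inverse `t ↦ inf {v > 0 | F(v) > t}` of the expected bid-counting function. -/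
def expectedBidCountInverse {Ω : Type*} [MeasurableSpace Ω] (μ : Measure Ω) (X : ℤ → Ω → ℝ)
    (t : ℝ) : ℝ :=
  sInf {v : ℝ | 0 < v ∧ t < expectedBidCount μ X v}

end OnlineBidding

end

/-! Let `N = bidCount` and let `F` be its expectation. Against `u`, the bids of size at least `v`
number `(N u - N v + 1)⁺`; the `+ 1` is the bid that reaches `u`, and it becomes the `t + 1` in
`normalizedMass`. Integrating over `v > 0` and taking expectations gives `𝔼 cost(u) = ∫ 𝔼 (N u - N v
+ 1)⁺ dv` (`lintegral_cost`). By Jensen this is at least `∫ (F u + 1 - F v)⁺ dv`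
(`lintegral_expectedBidCount_le`). For the generalized inverse `B` of `F`, the layer-cake formula
bounds the mass of `B` up to `F u + 1` by that same integral (`lintegral_sInf_lt_le`). So the mass
of `B` up to `F u + 1` is at most `𝔼 cost(u)`. Consistency follows at `t = F u`, where `B t ≥ u`;
robustness follows by letting `u` decrease to `B t`. If some expected cost is infinite, then `rob(X)
= ⊤`, and since `cons(X) ≥ 1` always, any bidding function of consistency at most `1` will do:
`factorialBid`. -/

namespace OnlineBidding

/-! ### Counting the bids of a deterministic sequence -/

theorem IsBiddingSequence.exists_index {x : ℤ → ℝ} (hx : IsBiddingSequence x) {u : ℝ}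
    (hu : 0 < u) : ∃ i : ℤ, ∀ k, x k < u ↔ k < i := by
  obtain ⟨i, h1, h2⟩ := hx.reaches u hu
  refine ⟨i, fun k => ⟨fun h => ?_, fun h => ?_⟩⟩
  · by_contra! hk
    linarith [hx.mono hk]
  · exact (hx.mono (show k ≤ i - 1 by omega)).trans_lt h1

open Classical in
/-- The index of the first bid that reaches `u` (junk value `0` if there is none). -/
noncomputable def reachIndex (x : ℤ → ℝ) (u : ℝ) : ℤ :=
  if h : ∃ i : ℤ, ∀ k, x k < u ↔ k < i then h.choose else 0

theorem IsBiddingSequence.lt_iff {x : ℤ → ℝ} (hx : IsBiddingSequence x) {u : ℝ}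
    (hu : 0 < u) (k : ℤ) : x k < u ↔ k < reachIndex x u := by
  have h := hx.exists_index hu
  rw [reachIndex, dif_pos h]
  exact h.choose_spec k

theorem IsBiddingSequence.le_iff {x : ℤ → ℝ} (hx : IsBiddingSequence x) {u : ℝ}
    (hu : 0 < u) (k : ℤ) : u ≤ x k ↔ reachIndex x u ≤ k := by
  rw [← not_lt, hx.lt_iff hu, not_lt]

theorem IsBiddingSequence.reachIndex_mono {x : ℤ → ℝ} (hx : IsBiddingSequence x) {u v : ℝ}
    (hu : 0 < u) (huv : u ≤ v) : reachIndex x u ≤ reachIndex x v := by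
  rw [← hx.le_iff hu]
  exact huv.trans ((hx.le_iff (hu.trans_le huv) _).2 le_rfl)

theorem hasSum_lt_sub_lt (a b : ℤ) :
    HasSum (fun k : ℤ => ((if k < a then 1 else 0) - (if k < b then 1 else 0) : ℝ))
      ((a : ℝ) - b) := by
  wlog hab : b ≤ a generalizing a b
  · simpa only [neg_sub] using (this b a (by omega)).neg
  have h := hasSum_sum_of_ne_finset_zero (L := .unconditional ℤ) (s := Finset.Ico b a)
    (f := fun k : ℤ => ((if k < a then 1 else 0) - (if k < b then 1 else 0) : ℝ)) (by
      intro k hk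
      rw [Finset.mem_Ico] at hk
      by_cases h1 : k < b
      · simp [h1, h1.trans_le hab]
      · have : ¬ k < a := fun h => hk ⟨not_lt.1 h1, h⟩
        simp [h1, this])
  convert h using 1
  rw [Finset.sum_congr rfl (g := fun _ => (1 : ℝ))]
  · have : ((a - b).toNat : ℝ) = a - b := by
      have : ((a - b).toNat : ℤ) = a - b := Int.toNat_of_nonneg (by omega)
      exact_mod_cast this
    simp [this]
  · intro k hk
    rw [Finset.mem_Ico] at hk
    simp [hk.2, not_lt.2 hk.1]

theorem IsBiddingSequence.hasSum_bidCount {x : ℤ → ℝ} (hx : IsBiddingSequence x) {v : ℝ}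
    (hv : 0 < v) :
    HasSum (fun k : ℤ => ((if x k < v then 1 else 0) - (if x k < 1 then 1 else 0) : ℝ))
      ((reachIndex x v : ℝ) - reachIndex x 1) := by
  simp only [hx.lt_iff hv, hx.lt_iff one_pos]
  exact hasSum_lt_sub_lt _ _

theorem IsBiddingSequence.bidCount_eq {x : ℤ → ℝ} (hx : IsBiddingSequence x) {v : ℝ}
    (hv : 0 < v) : bidCount x v = (reachIndex x v : ℝ) - reachIndex x 1 :=
  (hx.hasSum_bidCount hv).tsum_eq

theorem IsBiddingSequence.bidCount_mono {x : ℤ → ℝ} (hx : IsBiddingSequence x) {u v : ℝ}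
    (hu : 0 < u) (huv : u ≤ v) : bidCount x u ≤ bidCount x v := by
  rw [hx.bidCount_eq hu, hx.bidCount_eq (hu.trans_le huv)]
  have : (reachIndex x u : ℝ) ≤ reachIndex x v := by exact_mod_cast hx.reachIndex_mono hu huv
  linarith

theorem IsBiddingSequence.bidCount_one {x : ℤ → ℝ} (hx : IsBiddingSequence x) :
    bidCount x 1 = 0 := by
  simp [hx.bidCount_eq one_pos]

/-- Bid `j` is placed against the threshold `u` exactly if bid `j - 1` fails to reach `u`. -/
theorem IsBiddingSequence.cost_eq_tsum {x : ℤ → ℝ} (hx : IsBiddingSequence x) {u : ℝ}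
    (hu : 0 < u) :
    cost x u = ∑' j : ℤ, if x (j - 1) < u then ENNReal.ofReal (x j) else 0 := by
  rw [cost_eq hx ((hx.lt_iff hu _).2 (sub_one_lt (reachIndex x u))) ((hx.le_iff hu _).2 le_rfl),
    tsum_subtype (Set.Iic (reachIndex x u)) (fun j => ENNReal.ofReal (x j))]
  refine tsum_congr fun j => ?_
  rw [Set.indicator_apply]
  refine if_congr ?_ rfl rfl
  rw [hx.lt_iff hu, Set.mem_Iic]
  omega

theorem IsBiddingSequence.le_cost {x : ℤ → ℝ} (hx : IsBiddingSequence x) {u : ℝ}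
    (hu : 0 < u) : ENNReal.ofReal u ≤ cost x u := by
  rw [hx.cost_eq_tsum hu]
  refine le_trans ?_ (ENNReal.le_tsum (reachIndex x u))
  rw [if_pos ((hx.lt_iff hu _).2 (sub_one_lt (reachIndex x u)))]
  exact ENNReal.ofReal_le_ofReal ((hx.le_iff hu _).2 le_rfl)

/-- The number of bids of size at least `v` that are placed against the threshold `u`. -/
theorem IsBiddingSequence.tsum_placed_ge {x : ℤ → ℝ} (hx : IsBiddingSequence x) {u v : ℝ}
    (hu : 0 < u) (hv : 0 < v) :
    ∑' j : ℤ, (if x (j - 1) < u ∧ v ≤ x j then 1 else 0 : ℝ≥0∞) =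
      ENNReal.ofReal (bidCount x u - bidCount x v + 1) := by
  rw [hx.bidCount_eq hu, hx.bidCount_eq hv]
  have hiff : ∀ j : ℤ, (x (j - 1) < u ∧ v ≤ x j) ↔
      j ∈ Finset.Icc (reachIndex x v) (reachIndex x u) := by
    intro j
    rw [hx.lt_iff hu, hx.le_iff hv, Finset.mem_Icc]
    omega
  simp only [hiff]
  rw [tsum_eq_sum (s := Finset.Icc (reachIndex x v) (reachIndex x u))
    (fun j hj => if_neg hj), Finset.sum_congr rfl (g := fun _ => (1 : ℝ≥0∞))
    (fun j hj => if_pos hj)]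
  simp only [Finset.sum_const, Int.card_Icc, nsmul_eq_mul, mul_one]
  rw [show (reachIndex x u : ℝ) - reachIndex x 1 - (reachIndex x v - reachIndex x 1) + 1 =
    ((reachIndex x u + 1 - reachIndex x v : ℤ) : ℝ) by push_cast; ring]
  -- For `v` far above `u` this integer is negative; `Int.toNat` and `ENNReal.ofReal` then both
  -- truncate to `0`.
  generalize reachIndex x u + 1 - reachIndex x v = n
  rcases le_total 0 n with hn | hn
  · lift n to ℕ using hn
    simp
  · rw [Int.toNat_of_nonpos hn, ENNReal.ofReal_of_nonpos (by exact_mod_cast hn)]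
    simp

theorem IsBiddingSequence.tendsto_bidCount_atTop {x : ℤ → ℝ} (hx : IsBiddingSequence x) :
    Tendsto (fun n : ℕ => bidCount x (n + 1)) atTop atTop := by
  refine tendsto_atTop.2 fun b => ?_
  obtain ⟨K, hK⟩ := exists_int_gt (b + reachIndex x 1)
  obtain ⟨m, hm⟩ := exists_nat_gt (x K)
  filter_upwards [eventually_ge_atTop m] with n hn
  have hn' : (m : ℝ) ≤ n := by exact_mod_cast hn
  have h0 : (0 : ℝ) < n + 1 := by positivity
  have h1 : K < reachIndex x (n + 1) := (hx.lt_iff h0 K).1 (by linarith)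
  have h2 : (K : ℝ) < reachIndex x (n + 1) := by exact_mod_cast h1
  rw [hx.bidCount_eq h0]
  linarith

theorem IsBiddingSequence.tendsto_bidCount_inv {x : ℤ → ℝ} (hx : IsBiddingSequence x) :
    Tendsto (fun n : ℕ => -bidCount x ((n + 1 : ℝ)⁻¹)) atTop atTop := by
  refine tendsto_atTop.2 fun b => ?_
  obtain ⟨K, hK⟩ := exists_int_lt (reachIndex x 1 - b)
  have h := tendsto_inv_atTop_zero.comp
    (tendsto_atTop_add_const_right atTop (1 : ℝ) tendsto_natCast_atTop_atTop)
  filter_upwards [h.eventually_le_const (hx.pos K)] with n hn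
  have h0 : (0 : ℝ) < (n + 1 : ℝ)⁻¹ := by positivity
  have h1 : reachIndex x ((n + 1 : ℝ)⁻¹) ≤ K := (hx.le_iff h0 K).1 hn
  have h2 : (reachIndex x ((n + 1 : ℝ)⁻¹) : ℝ) ≤ K := by exact_mod_cast h1
  rw [hx.bidCount_eq h0]
  linarith

/-! ### Expected cost and integrability of the bid count -/

section RandomizedBiddingSequence

variable {Ω : Type*} [MeasurableSpace Ω] {μ : Measure Ω} {X : ℤ → Ω → ℝ}

theorem IsRandomizedBiddingSequence.aemeasurable_bidCount
    (hX : IsRandomizedBiddingSequence μ X) {v : ℝ} (hv : 0 < v) :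
    AEMeasurable (fun ω => bidCount (fun i => X i ω) v) μ := by
  refine aemeasurable_of_tendsto_metrizable_ae (atTop : Filter (Finset ℤ))
    (f := fun s ω => ∑ k ∈ s, ((if X k ω < v then 1 else 0) - (if X k ω < 1 then 1 else 0) : ℝ))
    (fun s => ?_) ?_
  · refine (Finset.measurable_fun_sum s fun k _ => ?_).aemeasurable
    exact (Measurable.ite (measurableSet_lt (hX.measurable k) measurable_const)
      measurable_const measurable_const).sub
      (Measurable.ite (measurableSet_lt (hX.measurable k) measurable_const)
      measurable_const measurable_const)
  · filter_upwards [hX.ae_isBiddingSequence] with ω hω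
    rw [hω.bidCount_eq hv]
    exact hω.hasSum_bidCount hv

/-- Each bid is the length of the set of `v > 0` below it, so Tonelli turns the sum of placed bids
into an integral of counts. -/
theorem IsRandomizedBiddingSequence.lintegral_cost [SFinite μ]
    (hX : IsRandomizedBiddingSequence μ X) {u : ℝ} (hu : 0 < u) :
    ∫⁻ ω, cost (fun i => X i ω) u ∂μ = ∫⁻ v in Set.Ioi (0 : ℝ), ∫⁻ ω,
      ENNReal.ofReal (bidCount (fun i => X i ω) u - bidCount (fun i => X i ω) v + 1) ∂μ := by
  have hmeas : ∀ j : ℤ, Measurable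
      (fun p : Ω × ℝ => (if X (j - 1) p.1 < u ∧ p.2 ≤ X j p.1 then 1 else 0 : ℝ≥0∞)) := by
    intro j
    refine Measurable.ite ?_ measurable_const measurable_const
    exact (measurableSet_lt ((hX.measurable _).comp measurable_fst) measurable_const).inter
      (measurableSet_le measurable_snd ((hX.measurable _).comp measurable_fst))
  calc ∫⁻ ω, cost (fun i => X i ω) u ∂μ
      = ∫⁻ ω, (∫⁻ v in Set.Ioi (0 : ℝ), ∑' j : ℤ,
          (if X (j - 1) ω < u ∧ v ≤ X j ω then 1 else 0 : ℝ≥0∞)) ∂μ := by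
        refine lintegral_congr_ae ?_
        filter_upwards [hX.ae_isBiddingSequence] with ω hω
        rw [hω.cost_eq_tsum hu, lintegral_tsum
          (f := fun j v => (if X (j - 1) ω < u ∧ v ≤ X j ω then 1 else 0 : ℝ≥0∞))
          fun j => ((hmeas j).comp measurable_prodMk_left).aemeasurable]
        refine tsum_congr fun j => ?_
        by_cases h : X (j - 1) ω < u
        · have : ∀ v : ℝ, (if v ≤ X j ω then 1 else 0 : ℝ≥0∞) =
              (Set.Iic (X j ω)).indicator 1 v := fun v => by
            simp [Set.indicator_apply]
          simp only [h, true_and, if_true, this]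
          rw [lintegral_indicator_one measurableSet_Iic,
            Measure.restrict_apply measurableSet_Iic, Set.Iic_inter_Ioi, Real.volume_Ioc, sub_zero]
        · simp [h]
    _ = ∫⁻ v in Set.Ioi (0 : ℝ), ∫⁻ ω, ∑' j : ℤ,
          (if X (j - 1) ω < u ∧ v ≤ X j ω then 1 else 0 : ℝ≥0∞) ∂μ :=
        lintegral_lintegral_swap (Measurable.tsum hmeas).aemeasurable
    _ = _ := by
        refine setLIntegral_congr_fun measurableSet_Ioi fun v hv => ?_
        refine lintegral_congr_ae ?_
        filter_upwards [hX.ae_isBiddingSequence] with ω hω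
        exact hω.tsum_placed_ge hu hv

/-- At every level `w ∈ (0, v]` the integrand of `lintegral_cost` dominates `𝔼 (N u - N v)`, so `v *
𝔼 (N u - N v)` is at most the finite expected cost. -/
theorem IsRandomizedBiddingSequence.integrable_bidCount_sub [SFinite μ]
    (hX : IsRandomizedBiddingSequence μ X) {u v : ℝ} (hv : 0 < v) (hvu : v ≤ u)
    (hfin : ∫⁻ ω, cost (fun i => X i ω) u ∂μ ≠ ⊤) :
    Integrable (fun ω => bidCount (fun i => X i ω) u - bidCount (fun i => X i ω) v) μ := by
  have hu := hv.trans_le hvu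
  refine ⟨((hX.aemeasurable_bidCount hu).sub (hX.aemeasurable_bidCount hv)).aestronglyMeasurable, ?_⟩
  rw [hasFiniteIntegral_iff_ofReal (by
    filter_upwards [hX.ae_isBiddingSequence] with ω hω
    exact sub_nonneg.2 (hω.bidCount_mono hv hvu))]
  have hle : ENNReal.ofReal v * ∫⁻ ω,
      ENNReal.ofReal (bidCount (fun i => X i ω) u - bidCount (fun i => X i ω) v) ∂μ ≤
      ∫⁻ ω, cost (fun i => X i ω) u ∂μ := by
    rw [hX.lintegral_cost hu]
    calc _ = ∫⁻ _ in Set.Ioc 0 v, ∫⁻ ω, ENNReal.ofReal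
          (bidCount (fun i => X i ω) u - bidCount (fun i => X i ω) v) ∂μ := by
          rw [setLIntegral_const, Real.volume_Ioc, sub_zero, mul_comm]
      _ ≤ ∫⁻ w in Set.Ioc 0 v, ∫⁻ ω, ENNReal.ofReal
          (bidCount (fun i => X i ω) u - bidCount (fun i => X i ω) w + 1) ∂μ := by
          refine setLIntegral_mono' measurableSet_Ioc fun w hw => lintegral_mono_ae ?_
          filter_upwards [hX.ae_isBiddingSequence] with ω hω
          refine ENNReal.ofReal_le_ofReal ?_
          linarith [hω.bidCount_mono hw.1 hw.2]
      _ ≤ _ := lintegral_mono_set fun w hw => hw.1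
  by_contra h
  rw [not_lt, top_le_iff] at h
  rw [h, ENNReal.mul_top (by simpa using hv), top_le_iff] at hle
  exact hfin hle

theorem IsRandomizedBiddingSequence.integrable_bidCount [SFinite μ]
    (hX : IsRandomizedBiddingSequence μ X)
    (hfin : ∀ u, 0 < u → ∫⁻ ω, cost (fun i => X i ω) u ∂μ ≠ ⊤) {v : ℝ} (hv : 0 < v) :
    Integrable (fun ω => bidCount (fun i => X i ω) v) μ := by
  rcases le_total v 1 with h | h
  · refine (hX.integrable_bidCount_sub hv h (hfin 1 one_pos)).neg.congr ?_
    filter_upwards [hX.ae_isBiddingSequence] with ω hω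
    simp [hω.bidCount_one]
  · refine (hX.integrable_bidCount_sub one_pos h (hfin v hv)).congr ?_
    filter_upwards [hX.ae_isBiddingSequence] with ω hω
    simp [hω.bidCount_one]

theorem IsRandomizedBiddingSequence.expectedBidCount_mono [SFinite μ]
    (hX : IsRandomizedBiddingSequence μ X)
    (hfin : ∀ u, 0 < u → ∫⁻ ω, cost (fun i => X i ω) u ∂μ ≠ ⊤) {u v : ℝ} (hu : 0 < u)
    (huv : u ≤ v) : expectedBidCount μ X u ≤ expectedBidCount μ X v := by
  refine integral_mono_ae (hX.integrable_bidCount hfin hu)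
    (hX.integrable_bidCount hfin (hu.trans_le huv)) ?_
  filter_upwards [hX.ae_isBiddingSequence] with ω hω
  exact hω.bidCount_mono hu huv

/-- Monotone convergence to the constant `⊤`; used to show that `F` is unbounded in both directions.
-/
theorem exists_lt_integral_of_tendsto_atTop [IsProbabilityMeasure μ] {f : ℕ → Ω → ℝ}
    (hf : ∀ n, Integrable (f n) μ) (hnn : ∀ n, 0 ≤ᵐ[μ] f n)
    (hmono : ∀ᵐ ω ∂μ, Monotone fun n => f n ω)
    (htop : ∀ᵐ ω ∂μ, Tendsto (fun n => f n ω) atTop atTop) (b : ℝ) :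
    ∃ n, b < ∫ ω, f n ω ∂μ := by
  have h := lintegral_tendsto_of_tendsto_of_monotone (μ := μ)
    (f := fun n ω => ENNReal.ofReal (f n ω)) (F := fun _ => ⊤)
    (fun n => (hf n).aemeasurable.ennreal_ofReal)
    (by filter_upwards [hmono] with ω hω i j hij using ENNReal.ofReal_le_ofReal (hω hij))
    (by filter_upwards [htop] with ω hω using ENNReal.tendsto_ofReal_atTop.comp hω)
  simp only [lintegral_const, measure_univ, mul_one] at h
  obtain ⟨n, hn⟩ := (h.eventually_const_lt (ENNReal.ofReal_lt_top (r := b))).exists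
  refine ⟨n, ?_⟩
  rw [← ofReal_integral_eq_lintegral_ofReal (hf n) (hnn n)] at hn
  exact lt_of_not_ge fun hle => hn.not_ge (ENNReal.ofReal_le_ofReal hle)

end RandomizedBiddingSequence

/-! ### Generalized inverse of a monotone function on the positive reals -/

section GeneralizedInverse

variable {F : ℝ → ℝ}

theorem sInf_lt_le_of_lt {t v : ℝ} (hv : 0 < v) (h : t < F v) :
    sInf {v : ℝ | 0 < v ∧ t < F v} ≤ v :=
  csInf_le ⟨0, fun _ hw => hw.1.le⟩ ⟨hv, h⟩

theorem le_sInf_lt_of_le (hmono : ∀ u v, 0 < u → u ≤ v → F u ≤ F v)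
    (htop : ∀ b, ∃ v, 0 < v ∧ b < F v) {t v : ℝ} (h : F v ≤ t) :
    v ≤ sInf {v : ℝ | 0 < v ∧ t < F v} := by
  refine le_csInf (htop t) fun w hw => ?_
  by_contra! hlt
  linarith [hmono w v hw.1 hlt.le, hw.2]

theorem lt_of_sInf_lt_lt (hmono : ∀ u v, 0 < u → u ≤ v → F u ≤ F v)
    (htop : ∀ b, ∃ v, 0 < v ∧ b < F v) {t v : ℝ} (h : sInf {v : ℝ | 0 < v ∧ t < F v} < v) :
    t < F v := by
  by_contra! hle
  exact h.not_ge (le_sInf_lt_of_le hmono htop hle)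

theorem sInf_lt_mono (htop : ∀ b, ∃ v, 0 < v ∧ b < F v) :
    Monotone fun t => sInf {v : ℝ | 0 < v ∧ t < F v} := fun _ t hst =>
  csInf_le_csInf ⟨0, fun _ hw => hw.1.le⟩ (htop t) fun _ hw => ⟨hw.1, hst.trans_lt hw.2⟩

theorem sInf_lt_pos (hmono : ∀ u v, 0 < u → u ≤ v → F u ≤ F v)
    (htop : ∀ b, ∃ v, 0 < v ∧ b < F v) (hbot : ∀ b, ∃ v, 0 < v ∧ F v < b) (t : ℝ) :
    0 < sInf {v : ℝ | 0 < v ∧ t < F v} := by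
  obtain ⟨v, hv, h⟩ := hbot t
  exact hv.trans_le (le_sInf_lt_of_le hmono htop h.le)

theorem isBiddingFunction_sInf_lt (hmono : ∀ u v, 0 < u → u ≤ v → F u ≤ F v)
    (htop : ∀ b, ∃ v, 0 < v ∧ b < F v) (hbot : ∀ b, ∃ v, 0 < v ∧ F v < b)
    (hint : ∀ u, 0 < u → ∫⁻ x in Set.Iic (F u + 1),
      ENNReal.ofReal (sInf {v : ℝ | 0 < v ∧ x < F v}) ≠ ⊤) :
    IsBiddingFunction fun t => sInf {v : ℝ | 0 < v ∧ t < F v} where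
  pos := sInf_lt_pos hmono htop hbot
  mono := sInf_lt_mono htop
  tendsto_atBot := by
    have hpos := sInf_lt_pos hmono htop hbot
    refine tendsto_order.2 ⟨fun a ha => Eventually.of_forall fun t => ha.trans (hpos t),
      fun a ha => ?_⟩
    -- The inverse is only bounded weakly by `a / 2`, which leaves room for the strict bound by `a`.
    filter_upwards [eventually_lt_atBot (F (a / 2))] with t ht
    exact (sInf_lt_le_of_lt (half_pos ha) ht).trans_lt (half_lt_self ha)
  tendsto_atTop := by
    refine tendsto_atTop.2 fun b => ?_
    filter_upwards [eventually_ge_atTop (F b)] with t ht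
    exact le_sInf_lt_of_le hmono htop ht
  integrableOn t := by
    obtain ⟨u, hu, h⟩ := htop t
    have hpos := sInf_lt_pos hmono htop hbot
    refine IntegrableOn.mono_set (t := Set.Iic (F u + 1)) ?_ (Set.Iic_subset_Iic.2 (by linarith))
    refine ⟨(sInf_lt_mono htop).measurable.aestronglyMeasurable, ?_⟩
    rw [hasFiniteIntegral_iff_ofReal (Eventually.of_forall fun x => (hpos x).le)]
    exact (hint u hu).lt_top

/-- Layer cake: if the inverse at `x ≤ a` exceeds `v`, then `F v ≤ x`, so the superlevel set lies in
`[F v, a]`, of length `(a - F v)⁺`. -/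
theorem lintegral_sInf_lt_le (hmono : ∀ u v, 0 < u → u ≤ v → F u ≤ F v)
    (htop : ∀ b, ∃ v, 0 < v ∧ b < F v) (hbot : ∀ b, ∃ v, 0 < v ∧ F v < b) (a : ℝ) :
    ∫⁻ x in Set.Iic a, ENNReal.ofReal (sInf {v : ℝ | 0 < v ∧ x < F v}) ≤
      ∫⁻ v in Set.Ioi (0 : ℝ), ENNReal.ofReal (a - F v) := by
  rw [lintegral_eq_lintegral_meas_lt _
    (Eventually.of_forall fun x => (sInf_lt_pos hmono htop hbot x).le)
    (sInf_lt_mono htop).measurable.aemeasurable]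
  refine setLIntegral_mono' measurableSet_Ioi fun v hv => ?_
  rw [Measure.restrict_apply' measurableSet_Iic, ← Real.volume_Icc]
  refine measure_mono fun x hx => ⟨?_, hx.2⟩
  by_contra! hlt
  exact (sInf_lt_le_of_lt hv hlt).not_gt hx.1

end GeneralizedInverse

theorem IsBiddingFunction.normalizedMass_eq {B : ℝ → ℝ} (hB : IsBiddingFunction B) (t : ℝ) :
    normalizedMass B t =
      (∫⁻ x in Set.Iic (t + 1), ENNReal.ofReal (B x)) / ENNReal.ofReal (B t) := by
  simp only [normalizedMass, ENNReal.ofReal_div_of_pos (hB.pos t)]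
  simp only [div_eq_mul_inv]
  exact lintegral_mul_const' _ _ (ENNReal.inv_ne_top.2 (by simpa using hB.pos t))

/-- Jensen's inequality for the positive part. -/
theorem ofReal_integral_le_lintegral_ofReal {α : Type*} [MeasurableSpace α] {μ : Measure α}
    {f : α → ℝ} (hf : Integrable f μ) :
    ENNReal.ofReal (∫ a, f a ∂μ) ≤ ∫⁻ a, ENNReal.ofReal (f a) ∂μ := by
  refine ENNReal.ofReal_le_of_le_toReal ?_
  rw [integral_eq_lintegral_pos_part_sub_lintegral_neg_part hf]
  exact sub_le_self _ ENNReal.toReal_nonneg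

/-! ### The inverse of the expected bid count -/

section ExpectedBidCount

variable {Ω : Type*} [MeasurableSpace Ω] {μ : Measure Ω} [IsProbabilityMeasure μ] {X : ℤ → Ω → ℝ}

theorem IsRandomizedBiddingSequence.exists_lt_expectedBidCount
    (hX : IsRandomizedBiddingSequence μ X)
    (hfin : ∀ u, 0 < u → ∫⁻ ω, cost (fun i => X i ω) u ∂μ ≠ ⊤) (b : ℝ) :
    ∃ v, 0 < v ∧ b < expectedBidCount μ X v := by
  have hpos : ∀ n : ℕ, (0 : ℝ) < n + 1 := fun n => by positivity
  obtain ⟨n, hn⟩ := exists_lt_integral_of_tendsto_atTop (μ := μ)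
    (f := fun n ω => bidCount (fun i => X i ω) (n + 1))
    (fun n => hX.integrable_bidCount hfin (hpos n))
    (fun n => by
      filter_upwards [hX.ae_isBiddingSequence] with ω hω
      exact hω.bidCount_one.ge.trans (hω.bidCount_mono one_pos (by simp)))
    (by
      filter_upwards [hX.ae_isBiddingSequence] with ω hω m n hmn
      exact hω.bidCount_mono (hpos m) (by gcongr))
    (by filter_upwards [hX.ae_isBiddingSequence] with ω hω using hω.tendsto_bidCount_atTop) b
  exact ⟨n + 1, hpos n, hn⟩

theorem IsRandomizedBiddingSequence.exists_expectedBidCount_lt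
    (hX : IsRandomizedBiddingSequence μ X)
    (hfin : ∀ u, 0 < u → ∫⁻ ω, cost (fun i => X i ω) u ∂μ ≠ ⊤) (b : ℝ) :
    ∃ v, 0 < v ∧ expectedBidCount μ X v < b := by
  have hpos : ∀ n : ℕ, (0 : ℝ) < (n + 1 : ℝ)⁻¹ := fun n => by positivity
  obtain ⟨n, hn⟩ := exists_lt_integral_of_tendsto_atTop (μ := μ)
    (f := fun n ω => -bidCount (fun i => X i ω) ((n + 1 : ℝ)⁻¹))
    (fun n => (hX.integrable_bidCount hfin (hpos n)).neg)
    (fun n => by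
      filter_upwards [hX.ae_isBiddingSequence] with ω hω
      have h := hω.bidCount_mono (hpos n) (inv_le_one_of_one_le₀ (by simp))
      rw [hω.bidCount_one] at h
      exact neg_nonneg.2 h)
    (by
      filter_upwards [hX.ae_isBiddingSequence] with ω hω m n hmn
      exact neg_le_neg (hω.bidCount_mono (hpos n) (by gcongr)))
    (by filter_upwards [hX.ae_isBiddingSequence] with ω hω using hω.tendsto_bidCount_inv) (-b)
  rw [integral_neg] at hn
  exact ⟨(n + 1 : ℝ)⁻¹, hpos n, neg_lt_neg_iff.1 hn⟩

theorem IsRandomizedBiddingSequence.lintegral_expectedBidCount_le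
    (hX : IsRandomizedBiddingSequence μ X)
    (hfin : ∀ u, 0 < u → ∫⁻ ω, cost (fun i => X i ω) u ∂μ ≠ ⊤) {u : ℝ} (hu : 0 < u) :
    ∫⁻ v in Set.Ioi (0 : ℝ),
        ENNReal.ofReal (expectedBidCount μ X u + 1 - expectedBidCount μ X v) ≤
      ∫⁻ ω, cost (fun i => X i ω) u ∂μ := by
  rw [hX.lintegral_cost hu]
  refine setLIntegral_mono' measurableSet_Ioi fun v hv => ?_
  have hiu := hX.integrable_bidCount hfin hu
  have hiv := hX.integrable_bidCount hfin hv
  have heq : expectedBidCount μ X u + 1 - expectedBidCount μ X v =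
      ∫ ω, (bidCount (fun i => X i ω) u - bidCount (fun i => X i ω) v + 1) ∂μ := by
    rw [integral_add (f := fun ω => bidCount (fun i => X i ω) u - bidCount (fun i => X i ω) v)
      (hiu.sub hiv) (integrable_const _), integral_sub hiu hiv]
    simp only [expectedBidCount, integral_const, probReal_univ, smul_eq_mul, mul_one]
    ring
  rw [heq]
  exact ofReal_integral_le_lintegral_ofReal ((hiu.sub hiv).add (integrable_const 1))

theorem IsRandomizedBiddingSequence.lintegral_expectedBidCountInverse_le
    (hX : IsRandomizedBiddingSequence μ X)
    (hfin : ∀ u, 0 < u → ∫⁻ ω, cost (fun i => X i ω) u ∂μ ≠ ⊤) {u : ℝ} (hu : 0 < u) :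
    ∫⁻ x in Set.Iic (expectedBidCount μ X u + 1),
        ENNReal.ofReal (expectedBidCountInverse μ X x) ≤
      ∫⁻ ω, cost (fun i => X i ω) u ∂μ :=
  (lintegral_sInf_lt_le (fun _ _ => hX.expectedBidCount_mono hfin)
    (hX.exists_lt_expectedBidCount hfin) (hX.exists_expectedBidCount_lt hfin) _).trans
    (hX.lintegral_expectedBidCount_le hfin hu)

theorem IsRandomizedBiddingSequence.isBiddingFunction_expectedBidCountInverse
    (hX : IsRandomizedBiddingSequence μ X)
    (hfin : ∀ u, 0 < u → ∫⁻ ω, cost (fun i => X i ω) u ∂μ ≠ ⊤) :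
    IsBiddingFunction (expectedBidCountInverse μ X) :=
  isBiddingFunction_sInf_lt (fun _ _ => hX.expectedBidCount_mono hfin)
    (hX.exists_lt_expectedBidCount hfin) (hX.exists_expectedBidCount_lt hfin)
    fun _ hu => ne_top_of_le_ne_top (hfin _ hu) (hX.lintegral_expectedBidCountInverse_le hfin hu)

theorem IsRandomizedBiddingSequence.fctConsistency_expectedBidCountInverse_le
    (hX : IsRandomizedBiddingSequence μ X)
    (hfin : ∀ u, 0 < u → ∫⁻ ω, cost (fun i => X i ω) u ∂μ ≠ ⊤) :
    fctConsistency (expectedBidCountInverse μ X) ≤ seqConsistency μ X := by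
  refine le_iInf₂ fun u hu => iInf_le_of_le (expectedBidCount μ X u) ?_
  rw [(hX.isBiddingFunction_expectedBidCountInverse hfin).normalizedMass_eq]
  refine ENNReal.div_le_div (hX.lintegral_expectedBidCountInverse_le hfin hu)
    (ENNReal.ofReal_le_ofReal ?_)
  exact le_sInf_lt_of_le (fun _ _ => hX.expectedBidCount_mono hfin)
    (hX.exists_lt_expectedBidCount hfin) le_rfl

theorem IsRandomizedBiddingSequence.fctRobustness_expectedBidCountInverse_le
    (hX : IsRandomizedBiddingSequence μ X)
    (hfin : ∀ u, 0 < u → ∫⁻ ω, cost (fun i => X i ω) u ∂μ ≠ ⊤) :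
    fctRobustness (expectedBidCountInverse μ X) ≤ seqRobustness μ X := by
  have hB := hX.isBiddingFunction_expectedBidCountInverse hfin
  by_cases hrob : seqRobustness μ X = ⊤
  · simp [hrob]
  -- `F` may jump over `t`, so `t` is compared with thresholds `u > B t`, where `t < F u`. Finite
  -- robustness lets the bound `rob(X) * u` pass to the limit `u ↓ B t`.
  refine iSup_le fun t => ?_
  rw [hB.normalizedMass_eq]
  refine ENNReal.div_le_of_le_mul ?_
  have hlim : Tendsto (fun u => seqRobustness μ X * ENNReal.ofReal u)
      (𝓝[>] expectedBidCountInverse μ X t)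
      (𝓝 (seqRobustness μ X * ENNReal.ofReal (expectedBidCountInverse μ X t))) :=
    ENNReal.Tendsto.const_mul
      ((ENNReal.continuous_ofReal.tendsto _).mono_left nhdsWithin_le_nhds) (Or.inr hrob)
  refine ge_of_tendsto hlim ?_
  filter_upwards [self_mem_nhdsWithin] with u hu
  have hu0 : 0 < u := (hB.pos t).trans hu
  have ht : t < expectedBidCount μ X u := lt_of_sInf_lt_lt
    (fun _ _ => hX.expectedBidCount_mono hfin) (hX.exists_lt_expectedBidCount hfin) hu
  calc _ ≤ ∫⁻ x in Set.Iic (expectedBidCount μ X u + 1),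
        ENNReal.ofReal (expectedBidCountInverse μ X x) :=
        lintegral_mono_set (Set.Iic_subset_Iic.2 (by linarith))
    _ ≤ ∫⁻ ω, cost (fun i => X i ω) u ∂μ := hX.lintegral_expectedBidCountInverse_le hfin hu0
    _ = normalizedCost μ X u * ENNReal.ofReal u :=
        (ENNReal.div_mul_cancel (by simpa using hu0) ENNReal.ofReal_ne_top).symm
    _ ≤ _ := by
        gcongr
        exact le_iSup₂ (f := fun u (_ : 0 < u) => normalizedCost μ X u) u hu0

/-- The bid that reaches `u` alone costs at least `u`. -/
theorem IsRandomizedBiddingSequence.one_le_seqConsistency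
    (hX : IsRandomizedBiddingSequence μ X) : 1 ≤ seqConsistency μ X := by
  refine le_iInf₂ fun u hu => ?_
  rw [normalizedCost, ENNReal.le_div_iff_mul_le (Or.inl (by simpa using hu))
    (Or.inl ENNReal.ofReal_ne_top), one_mul]
  calc ENNReal.ofReal u = ∫⁻ _, ENNReal.ofReal u ∂μ := by simp
    _ ≤ _ := lintegral_mono_ae (by
      filter_upwards [hX.ae_isBiddingSequence] with ω hω using hω.le_cost hu)

end ExpectedBidCount

/-! ### A bidding function for the case of infinite robustness -/

/-- A bidding function with consistency at most `1` (and infinite robustness): it is constant on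
the intervals `[2n, 2n + 2)`, and its values there grow superexponentially. -/
noncomputable def factorialBid (t : ℝ) : ℝ :=
  if t < 0 then Real.exp t else (Nat.factorial ⌊t / 2⌋₊ : ℝ) ^ 2

theorem one_le_factorial_sq (n : ℕ) : (1 : ℝ) ≤ (Nat.factorial n : ℝ) ^ 2 :=
  one_le_pow₀ (by exact_mod_cast n.factorial_pos)

theorem factorialBid_pos (t : ℝ) : 0 < factorialBid t := by
  unfold factorialBid
  split_ifs
  · exact Real.exp_pos t
  · exact one_pos.trans_le (one_le_factorial_sq _)

theorem factorialBid_mono : Monotone factorialBid := by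
  intro s t hst
  unfold factorialBid
  split_ifs with hs ht ht
  · exact Real.exp_le_exp.2 hst
  · exact (Real.exp_le_one_iff.2 hs.le).trans (one_le_factorial_sq _)
  · exact absurd (hst.trans_lt ht) hs
  · gcongr

theorem isBiddingFunction_factorialBid : IsBiddingFunction factorialBid where
  pos := factorialBid_pos
  mono := factorialBid_mono
  tendsto_atBot := by
    refine Real.tendsto_exp_atBot.congr' ?_
    filter_upwards [eventually_lt_atBot 0] with t ht
    exact (if_pos ht).symm
  tendsto_atTop := by
    refine tendsto_atTop_mono' atTop ?_ (tendsto_natCast_atTop_atTop.comp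
      (tendsto_nat_floor_atTop.comp (tendsto_id.atTop_div_const (two_pos : (0 : ℝ) < 2))))
    filter_upwards [eventually_ge_atTop 0] with t ht
    rw [factorialBid, if_neg (not_lt.2 ht)]
    have h : ((⌊t / 2⌋₊ : ℕ) : ℝ) ≤ (Nat.factorial ⌊t / 2⌋₊ : ℝ) := by
      exact_mod_cast Nat.self_le_factorial _
    refine h.trans (le_self_pow₀ ?_ two_ne_zero)
    exact_mod_cast Nat.factorial_pos _
  integrableOn t := by
    have h1 : IntegrableOn factorialBid (Set.Iio 0) :=
      ((integrableOn_exp_Iic 0).mono_set Set.Iio_subset_Iic_self).congr_fun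
        (fun x hx => (if_pos hx).symm) measurableSet_Iio
    have h2 : IntegrableOn factorialBid (Set.Icc 0 t) :=
      (factorialBid_mono.monotoneOn _).integrableOn_isCompact isCompact_Icc
    refine (h1.union h2).mono_set fun x hx => ?_
    rcases lt_or_ge x 0 with h | h
    · exact Or.inl h
    · exact Or.inr ⟨h, hx⟩

/-- Since steps have length `2`, the last unit interval stays on the step of the reference point and
contributes at most `1`. Earlier steps have total length `2 * (n + 1)` and relative height at most
`1 / (n + 1) ^ 2` thanks to the squared factorial, hence `2 / (n + 1)`. The exponential tail adds at
most `1 / (n + 1)`. -/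
theorem normalizedMass_factorialBid_le (n : ℕ) :
    normalizedMass factorialBid (2 * (n + 1)) ≤ ENNReal.ofReal (1 + 3 / (n + 1)) := by
  have hn : (0 : ℝ) < n + 1 := by positivity
  have hval : factorialBid (2 * (n + 1)) = (n + 1) ^ 2 * (Nat.factorial n : ℝ) ^ 2 := by
    rw [factorialBid, if_neg (by linarith), mul_div_cancel_left₀ _ two_ne_zero,
      show (n : ℝ) + 1 = ((n + 1 : ℕ) : ℝ) by push_cast; ring, Nat.floor_natCast,
      Nat.factorial_succ]
    push_cast
    ring
  have hsub : Set.Iic (2 * (n + 1) + 1 : ℝ) ⊆ Set.Iio 0 ∪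
      (Set.Ico 0 (2 * (n + 1) : ℝ) ∪ Set.Icc (2 * (n + 1) : ℝ) (2 * (n + 1) + 1)) := by
    intro x hx
    rcases lt_or_ge x 0 with h | h
    · exact Or.inl h
    rcases lt_or_ge x (2 * (n + 1)) with h' | h'
    · exact Or.inr (Or.inl ⟨h, h'⟩)
    · exact Or.inr (Or.inr ⟨h', hx⟩)
  have hfac := one_le_factorial_sq n
  have h1 : ∫⁻ x in Set.Iio (0 : ℝ), ENNReal.ofReal (factorialBid x / factorialBid (2 * (n + 1)))
      ≤ ENNReal.ofReal (1 / (n + 1)) := by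
    calc _ ≤ ∫⁻ x in Set.Iio (0 : ℝ), ENNReal.ofReal (1 / (n + 1) * Real.exp x) := by
          refine setLIntegral_mono' measurableSet_Iio fun x hx => ENNReal.ofReal_le_ofReal ?_
          rw [hval, factorialBid, if_pos (Set.mem_Iio.1 hx), div_mul_eq_mul_div, one_mul]
          gcongr
          nlinarith [mul_le_mul_of_nonneg_left hfac (sq_nonneg ((n : ℝ) + 1))]
      _ = ENNReal.ofReal (1 / (n + 1) * ∫ x in Set.Iio (0 : ℝ), Real.exp x) := by
          rw [← integral_const_mul, ofReal_integral_eq_lintegral_ofReal]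
          · exact ((integrableOn_exp_Iic 0).mono_set Set.Iio_subset_Iic_self).const_mul _
          · exact Eventually.of_forall fun x => by positivity
      _ = _ := by
          rw [← integral_Iic_eq_integral_Iio, integral_exp_Iic_zero, mul_one]
  have h2 : ∫⁻ x in Set.Ico (0 : ℝ) (2 * (n + 1)),
      ENNReal.ofReal (factorialBid x / factorialBid (2 * (n + 1))) ≤
      ENNReal.ofReal (2 / (n + 1)) := by
    calc _ ≤ ∫⁻ x in Set.Ico (0 : ℝ) (2 * (n + 1)), ENNReal.ofReal (1 / (n + 1) ^ 2) := by
          refine setLIntegral_mono' measurableSet_Ico fun x hx => ENNReal.ofReal_le_ofReal ?_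
          have hfl : ⌊x / 2⌋₊ ≤ n := by
            rw [← Nat.lt_add_one_iff, Nat.floor_lt (by linarith [hx.1])]
            push_cast
            linarith [hx.2]
          rw [hval, factorialBid, if_neg (not_lt.2 hx.1), div_le_div_iff₀ (by positivity)
            (by positivity), one_mul, mul_comm]
          gcongr
      _ = _ := by
          rw [setLIntegral_const, Real.volume_Ico, ← ENNReal.ofReal_mul (by positivity)]
          congr 1
          field_simp
          ring
  have h3 : ∫⁻ x in Set.Icc (2 * (n + 1) : ℝ) (2 * (n + 1) + 1),
      ENNReal.ofReal (factorialBid x / factorialBid (2 * (n + 1))) ≤ ENNReal.ofReal 1 := by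
    calc _ ≤ ∫⁻ x in Set.Icc (2 * (n + 1) : ℝ) (2 * (n + 1) + 1), ENNReal.ofReal 1 := by
          refine setLIntegral_mono' measurableSet_Icc fun x hx => ENNReal.ofReal_le_ofReal ?_
          have hfl : ⌊x / 2⌋₊ ≤ n + 1 := by
            rw [← Nat.lt_add_one_iff, Nat.floor_lt (by linarith [hx.1])]
            push_cast
            linarith [hx.2]
          refine div_le_one_of_le₀ ?_ (factorialBid_pos _).le
          have hfl' := Nat.factorial_le hfl
          rw [hval, factorialBid, if_neg (by linarith [hx.1]), ← mul_pow]
          gcongr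
          rw [Nat.factorial_succ] at hfl'
          exact_mod_cast hfl'
      _ = _ := by
          rw [setLIntegral_const, Real.volume_Icc]
          simp
  calc normalizedMass factorialBid (2 * (n + 1))
      ≤ ENNReal.ofReal (1 / (n + 1)) + (ENNReal.ofReal (2 / (n + 1)) + ENNReal.ofReal 1) :=
        (lintegral_mono_set hsub).trans ((lintegral_union_le _ _ _).trans
          (add_le_add h1 ((lintegral_union_le _ _ _).trans (add_le_add h2 h3))))
    _ = _ := by
        rw [← ENNReal.ofReal_add (by positivity) one_pos.le,
          ← ENNReal.ofReal_add (by positivity) (by positivity)]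
        congr 1
        ring

theorem fctConsistency_factorialBid_le_one : fctConsistency factorialBid ≤ 1 := by
  have hlim : Tendsto (fun n : ℕ => ENNReal.ofReal (1 + 3 / (n + 1))) atTop (𝓝 1) := by
    have h : Tendsto (fun n : ℕ => (1 + 3 / (n + 1) : ℝ)) atTop (𝓝 (1 + 0)) :=
      tendsto_const_nhds.add (tendsto_const_nhds.div_atTop
        (tendsto_atTop_add_const_right atTop (1 : ℝ) tendsto_natCast_atTop_atTop))
    simpa using ENNReal.tendsto_ofReal h
  exact ge_of_tendsto' hlim fun n => (iInf_le _ _).trans (normalizedMass_factorialBid_le n)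

end OnlineBidding

/-! ### The two cases combined -/

theorem theorem3p2 {Ω : Type*} [MeasurableSpace Ω] (μ : MeasureTheory.Measure Ω)
    [MeasureTheory.IsProbabilityMeasure μ] (X : ℤ → Ω → ℝ)
    (hX : OnlineBidding.IsRandomizedBiddingSequence μ X) :
    ∃ B : ℝ → ℝ, OnlineBidding.IsBiddingFunction B ∧
      OnlineBidding.fctConsistency B ≤ OnlineBidding.seqConsistency μ X ∧
      OnlineBidding.fctRobustness B ≤ OnlineBidding.seqRobustness μ X ∧
      ((∀ u : ℝ, 0 < u → OnlineBidding.normalizedCost μ X u < ⊤) →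
        B = OnlineBidding.expectedBidCountInverse μ X) := by
  open OnlineBidding in
  by_cases hnc : ∀ u : ℝ, 0 < u → normalizedCost μ X u < ⊤
  · have hfin : ∀ u, 0 < u → ∫⁻ ω, cost (fun i => X i ω) u ∂μ ≠ ⊤ := fun u hu h => by
      have := hnc u hu
      rw [normalizedCost, h, ENNReal.top_div_of_ne_top ENNReal.ofReal_ne_top] at this
      exact this.false
    exact ⟨_, hX.isBiddingFunction_expectedBidCountInverse hfin,
      hX.fctConsistency_expectedBidCountInverse_le hfin,
      hX.fctRobustness_expectedBidCountInverse_le hfin, fun _ => rfl⟩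
  · refine ⟨factorialBid, isBiddingFunction_factorialBid,
      fctConsistency_factorialBid_le_one.trans hX.one_le_seqConsistency, ?_,
      fun h => absurd h hnc⟩
    push Not at hnc
    obtain ⟨u, hu, h⟩ := hnc
    exact le_top.trans (h.trans (le_iSup₂ (f := fun u (_ : 0 < u) => normalizedCost μ X u) u hu))
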